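/- Let $n\ge 2$ be an integer, let $d=2n$, let $\{\xi_1,\dots,\xi_d\}$ be an orthonormal basis of $\mathbb{C}^d$, and let $p$ be an integer with $p>7$. Identify $\mathbb{C}^d$ with $\mathbb{C}^2\otimes\mathbb{C}^n$ as Hilbert spaces in the standard way. Call a vector of $\mathbb{C}^d$ entangled if it is not of the form $a\otimes b$ with $a\in\mathbb{C}^2$, $b\in\mathbb{C}^n$, and call a set $S$ of (not necessarily normalized) vectors of $\mathbb{C}^d$ absolutely entangled for the split $(2,n)$ if for every unitary $U\in \mathrm{U}(d)$ there is some $\psi\in S$ such that $U\psi$ is entangled. Then for all but finitely many $x\in(0,1)$ the vectors $$\psi_i=\xi_i\quad(1\le i\le d-1),\qquad \psi_d=\sum_{j=1}^d x^{p^j}\,\xi_j,\qquad \psi_{d+1}=\sum_{j=1}^d x^{2p^j}\,\xi_j$$ form a set of $d+1=2n+1$ distinct vectors that is absolutely entangled for the split $(2,n)$. -/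

import Mathlib

open scoped TensorProduct

noncomputable section

/-- The identification of `ℂ^{d₁} ⊗ ℂ^{d₂}` (with its Hilbert space structure) and `ℂ^{d₁ d₂}`:
the standard product basis vector `e_i ⊗ e_j` goes to the standard basis vector whose index is
the lexicographic position of `(i, j)`. -/
def tensorIso (d₁ d₂ : ℕ) :
    EuclideanSpace ℂ (Fin d₁) ⊗[ℂ] EuclideanSpace ℂ (Fin d₂) ≃ₗᵢ[ℂ]
      EuclideanSpace ℂ (Fin (d₁ * d₂)) :=
  (((EuclideanSpace.basisFun (Fin d₁) ℂ).tensorProduct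
    (EuclideanSpace.basisFun (Fin d₂) ℂ)).reindex finProdFinEquiv).repr

/-- Coordinates of a product vector. -/
theorem tensorIso_tmul_apply {d₁ d₂ : ℕ} (a : EuclideanSpace ℂ (Fin d₁))
    (b : EuclideanSpace ℂ (Fin d₂)) (i : Fin d₁) (j : Fin d₂) :
    tensorIso d₁ d₂ (a ⊗ₜ[ℂ] b) (finProdFinEquiv (i, j)) = a i * b j := by
  simp [tensorIso, mul_comm]

/-- A vector of `ℂ^{d₁ d₂} = ℂ^{d₁} ⊗ ℂ^{d₂}` is in product form (separable). -/
def IsProductVector (d₁ d₂ : ℕ) (v : EuclideanSpace ℂ (Fin (d₁ * d₂))) : Prop :=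
  ∃ (a : EuclideanSpace ℂ (Fin d₁)) (b : EuclideanSpace ℂ (Fin d₂)),
    v = tensorIso d₁ d₂ (a ⊗ₜ[ℂ] b)

/-- A vector is entangled if it is not in product form. This does not depend on the
normalization of the vector. -/
def IsEntangled (d₁ d₂ : ℕ) (v : EuclideanSpace ℂ (Fin (d₁ * d₂))) : Prop :=
  ¬ IsProductVector d₁ d₂ v

/-- A set of (not necessarily normalized) states of `ℂ^{d₁ d₂}` is absolutely entangled with
respect to `(d₁, d₂)` if every global unitary leaves at least one of its states entangled. -/
def IsAbsolutelyEntangled (d₁ d₂ : ℕ) (S : Set (EuclideanSpace ℂ (Fin (d₁ * d₂)))) : Prop :=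
  ∀ U ∈ Matrix.unitaryGroup (Fin (d₁ * d₂)) ℂ,
    ∃ ψ ∈ S, IsEntangled d₁ d₂ (Matrix.toEuclideanLin U ψ)

/-- The vector `∑_{j=1}^{d} x^{m p^j} ξ_j`; the basis vector `ξ_j` is `ξ (j - 1)` here, since
`Fin d` starts at `0`. -/
def powerState {d : ℕ} (ξ : OrthonormalBasis (Fin d) ℂ (EuclideanSpace ℂ (Fin d)))
    (p m : ℕ) (x : ℝ) : EuclideanSpace ℂ (Fin d) :=
  ∑ j : Fin d, ((x ^ (m * p ^ ((j : ℕ) + 1)) : ℝ) : ℂ) • ξ j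

/-- The set of states `ξ_1, …, ξ_{d-1}`, `∑_j x^{p^j} ξ_j`, `∑_j x^{2 p^j} ξ_j`. -/
def stateSet {d : ℕ} (ξ : OrthonormalBasis (Fin d) ℂ (EuclideanSpace ℂ (Fin d)))
    (p : ℕ) (x : ℝ) : Set (EuclideanSpace ℂ (Fin d)) :=
  ξ '' {i : Fin d | (i : ℕ) + 1 < d} ∪ {powerState ξ p 1 x, powerState ξ p 2 x}

end

/-! If a unitary makes every state a product, it turns `ξ` into an orthonormal basis of ℂ² ⊗ ℂⁿ with
all vectors but one product; the last is then product too (`exists_eq_tmul_of_forall_ne`), so `e i =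
α i ⊗ β i`. A line of ℂ² has only one orthogonal line, which makes such bases rigid: for orthogonal
lines `c`, `c'`, the `β i` with `α i` on `c` and those with `α i` on `c'` span the same space
(`alignedForm_eq`). Hence the coordinates of two product vectors form the same angle on two disjoint
index sets `A`, `B`, with at least two indices in `A` (`exists_equalAngles`). For coordinates
x^(p^j) and x^(2p^j) this is a polynomial equation in x, and base-p digits show that it is not an
identity (`lacunaryPoly_mul_ne`). The finitely many pairs `(A, B)` exclude finitely many x. -/

/-- An orthonormal pair that spans a complex inner product space. -/
structure IsOrthonormalPair {E : Type*} [NormedAddCommGroup E] [InnerProductSpace ℂ E]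
    (c c' : E) : Prop where
  inner_left : inner ℂ c c = (1 : ℂ)
  inner_right : inner ℂ c' c' = (1 : ℂ)
  inner_eq_zero : inner ℂ c c' = (0 : ℂ)
  expand : ∀ x : E, x = (inner ℂ c x : ℂ) • c + (inner ℂ c' x : ℂ) • c'

namespace IsOrthonormalPair

variable {E : Type*} [NormedAddCommGroup E] [InnerProductSpace ℂ E] {c c' : E}

theorem inner_eq_zero' (h : IsOrthonormalPair c c') : inner ℂ c' c = (0 : ℂ) := by
  rw [← inner_conj_symm, h.inner_eq_zero, map_zero]

theorem symm (h : IsOrthonormalPair c c') : IsOrthonormalPair c' c where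
  inner_left := h.inner_right
  inner_right := h.inner_left
  inner_eq_zero := h.inner_eq_zero'
  expand x := by rw [add_comm]; exact h.expand x

theorem eq_smul_of_inner_eq_zero (h : IsOrthonormalPair c c') {x : E}
    (hx : inner ℂ c x = (0 : ℂ)) : x = (inner ℂ c' x : ℂ) • c' := by
  have := h.expand x
  rwa [hx, zero_smul, zero_add] at this

theorem inner_eq (h : IsOrthonormalPair c c') (x y : E) :
    (inner ℂ x y : ℂ) = inner ℂ x c * inner ℂ c y + inner ℂ x c' * inner ℂ c' y := by
  conv_lhs => rw [h.expand y]
  simp only [inner_add_right, inner_smul_right]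
  ring

end IsOrthonormalPair

/-- A unit vector of `ℂ²` belongs to an orthonormal pair. -/
theorem exists_isOrthonormalPair (c : EuclideanSpace ℂ (Fin 2)) (hc : inner ℂ c c = (1 : ℂ)) :
    ∃ c', IsOrthonormalPair c c' := by
  refine ⟨!₂[-(starRingEnd ℂ) (c 1), (starRingEnd ℂ) (c 0)], hc, ?_, ?_, fun x => ?_⟩
  all_goals simp only [PiLp.inner_apply, Fin.sum_univ_two, RCLike.inner_apply] at hc ⊢
  · simp
    linear_combination hc
  · simp
    ring
  · ext i
    fin_cases i
    · simp
      linear_combination (-x 0) * hc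
    · simp
      linear_combination (-x 1) * hc

/-! ### Orthonormal bases of product vectors. -/

section ProductBasis

variable {E F ι : Type*} [NormedAddCommGroup E] [InnerProductSpace ℂ E]
  [NormedAddCommGroup F] [InnerProductSpace ℂ F] [Fintype ι]

/-- A nonzero product vector is a multiple of the product of unit vectors. -/
theorem exists_unit_tmul {a : E} {b : F} (h : ‖a ⊗ₜ[ℂ] b‖ = 1) :
    ∃ (α : E) (β : F), inner ℂ α α = (1 : ℂ) ∧ inner ℂ β β = (1 : ℂ) ∧ a ⊗ₜ[ℂ] b = α ⊗ₜ[ℂ] β := by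
  rw [TensorProduct.norm_tmul] at h
  have ha : (‖a‖ : ℂ) ≠ 0 := by
    intro h0
    rw [Complex.ofReal_eq_zero] at h0
    simp [h0] at h
  have hab : (‖a‖ : ℂ) * ‖b‖ = 1 := by exact_mod_cast h
  refine ⟨(‖a‖ : ℂ)⁻¹ • a, (‖a‖ : ℂ) • b, ?_, ?_, ?_⟩
  · rw [inner_smul_left, inner_smul_right, inner_self_eq_norm_sq_to_K]
    simp only [map_inv₀, Complex.conj_ofReal, Complex.coe_algebraMap]
    field_simp
  · rw [inner_smul_left, inner_smul_right, inner_self_eq_norm_sq_to_K]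
    simp only [Complex.conj_ofReal, Complex.coe_algebraMap]
    linear_combination (‖a‖ * ‖b‖ + 1 : ℂ) * hab
  · rw [TensorProduct.smul_tmul_smul, inv_mul_cancel₀ ha, one_smul]

/-- In an orthonormal family of product vectors, second factors are orthogonal unless the
first ones are. -/
theorem inner_snd_eq_zero {e : OrthonormalBasis ι ℂ (E ⊗[ℂ] F)} {α : ι → E} {β : ι → F} {i j : ι}
    (hi : e i = α i ⊗ₜ β i) (hj : e j = α j ⊗ₜ β j) (hij : i ≠ j)
    (h : inner ℂ (α i) (α j) ≠ (0 : ℂ)) : inner ℂ (β i) (β j) = (0 : ℂ) := by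
  have : inner ℂ (e i) (e j) = (0 : ℂ) := e.orthonormal.2 hij
  rw [hi, hj, TensorProduct.inner_tmul] at this
  exact (mul_eq_zero.1 this).resolve_left h

theorem inner_tmul_smul (z : E ⊗[ℂ] F) (t : ℂ) (a : E) (b : F) :
    (inner ℂ z (a ⊗ₜ[ℂ] (t • b)) : ℂ) = t * inner ℂ z (a ⊗ₜ[ℂ] b) := by
  rw [TensorProduct.tmul_smul]
  exact inner_smul_right (𝕜 := ℂ) z (a ⊗ₜ[ℂ] b) t

theorem inner_smul_tmul (z : E ⊗[ℂ] F) (t : ℂ) (a : E) (b : F) :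
    (inner ℂ z ((t • a) ⊗ₜ[ℂ] b) : ℂ) = t * inner ℂ z (a ⊗ₜ[ℂ] b) := by
  rw [TensorProduct.smul_tmul, inner_tmul_smul]

theorem eq_zero_of_inner_tmul {z : E ⊗[ℂ] F} (h : ∀ a b, inner ℂ z (a ⊗ₜ[ℂ] b) = (0 : ℂ)) :
    z = 0 := by
  refine ext_inner_left ℂ fun w => ?_
  rw [inner_zero_right, ← inner_conj_symm, map_eq_zero]
  induction w with
  | zero => simp
  | tmul a b => exact h a b
  | add x y hx hy => rw [inner_add_right, hx, hy, add_zero]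

/-- An orthonormal basis of `ℂ² ⊗ F` in which all vectors but one are product vectors consists of
product vectors. -/
theorem exists_eq_tmul_of_forall_ne [FiniteDimensional ℂ F]
    (e : OrthonormalBasis ι ℂ (EuclideanSpace ℂ (Fin 2) ⊗[ℂ] F)) (k : ι)
    (α : ι → EuclideanSpace ℂ (Fin 2)) (β : ι → F)
    (he : ∀ i ≠ k, e i = α i ⊗ₜ β i) (hα : ∀ i ≠ k, inner ℂ (α i) (α i) = (1 : ℂ)) :
    ∃ a b, e k = a ⊗ₜ b := by
  classical
  by_contra hk
  have not_tmul : ∀ (t : ℂ) a b, t • e k = a ⊗ₜ b → t = 0 := by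
    intro t a b h
    by_contra ht
    exact hk ⟨a, t⁻¹ • b, by rw [TensorProduct.tmul_smul, ← h, smul_smul, inv_mul_cancel₀ ht,
      one_smul]⟩
  have expand : ∀ v, v = (inner ℂ (e k) v : ℂ) • e k +
      ∑ i ∈ Finset.univ.erase k, (inner ℂ (e i) v : ℂ) • e i := fun v => by
    rw [Finset.add_sum_erase _ (fun i => (inner ℂ (e i) v : ℂ) • e i) (Finset.mem_univ k),
      e.sum_repr']
  have inner_snd : ∀ j ≠ k, ∀ a, inner ℂ (e k) (a ⊗ₜ β j) = (0 : ℂ) := by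
    intro j hj a
    obtain ⟨c, hc⟩ := exists_isOrthonormalPair (α j) (hα j hj)
    have h1 : inner ℂ (e k) (α j ⊗ₜ β j) = (0 : ℂ) := by
      rw [← he j hj]
      exact e.orthonormal.2 hj.symm
    have h2 : inner ℂ (e k) (c ⊗ₜ β j) = (0 : ℂ) := by
      -- In the expansion of `c ⊗ β j` every term with `i ≠ k` has first factor `c`: either `α i`
      -- lies on the line of `c`, or the coefficient vanishes. So the `e k` term is a product as
      -- well, hence zero.
      have key : ∀ i ∈ Finset.univ.erase k, ∃ y : F,
          (inner ℂ (e i) (c ⊗ₜ β j) : ℂ) • e i = c ⊗ₜ y := by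
        intro i hi
        have hik : i ≠ k := Finset.ne_of_mem_erase hi
        rw [he i hik, TensorProduct.inner_tmul]
        by_cases h : inner ℂ (α i) (α j) = (0 : ℂ)
        · have h' : inner ℂ (α j) (α i) = (0 : ℂ) := by rw [← inner_conj_symm, h, map_zero]
          have := hc.eq_smul_of_inner_eq_zero h'
          refine ⟨(inner ℂ (α i) c * inner ℂ (β i) (β j) * inner ℂ c (α i) : ℂ) • β i, ?_⟩
          conv_lhs => enter [2]; rw [this]
          rw [← TensorProduct.smul_tmul', smul_smul, TensorProduct.tmul_smul]
        · refine ⟨0, ?_⟩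
          rw [TensorProduct.tmul_zero]
          by_cases hij : i = j
          · rw [hij, hc.inner_eq_zero, zero_mul, zero_smul]
          · rw [inner_snd_eq_zero (he i hik) (he j hj) hij h, mul_zero, zero_smul]
      choose! y hy using key
      refine not_tmul _ c (β j - ∑ i ∈ Finset.univ.erase k, y i) ?_
      rw [TensorProduct.tmul_sub, TensorProduct.tmul_sum, ← Finset.sum_congr rfl hy,
        eq_sub_iff_add_eq]
      exact (expand _).symm
    rw [hc.expand a, TensorProduct.add_tmul, inner_add_right, inner_smul_tmul, inner_smul_tmul,
      h1, h2, mul_zero, mul_zero, add_zero]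
  have hz : e k = 0 := by
    refine eq_zero_of_inner_tmul fun a b => ?_
    obtain ⟨u, hu, w, hw, rfl⟩ :=
      (Submodule.span ℂ (β '' {j | j ≠ k})).exists_add_mem_mem_orthogonal b
    rw [TensorProduct.tmul_add, inner_add_right]
    have hu0 : inner ℂ (e k) (a ⊗ₜ u) = (0 : ℂ) := by
      induction hu using Submodule.span_induction with
      | mem x hx => obtain ⟨j, hj, rfl⟩ := hx; exact inner_snd j hj a
      | zero => rw [TensorProduct.tmul_zero, inner_zero_right]
      | add x y _ _ hx hy => rw [TensorProduct.tmul_add, inner_add_right, hx, hy, add_zero]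
      | smul t x _ hx => rw [inner_tmul_smul, hx, mul_zero]
    -- `a ⊗ w` is orthogonal to every `e i` with `i ≠ k`, so it is a multiple of `e k`, and only the
    -- zero multiple is a product.
    have hw0 : inner ℂ (e k) (a ⊗ₜ w) = (0 : ℂ) := by
      refine not_tmul _ a w ?_
      conv_rhs => rw [expand (a ⊗ₜ w)]
      rw [left_eq_add]
      refine Finset.sum_eq_zero fun i hi => ?_
      have hik : i ≠ k := Finset.ne_of_mem_erase hi
      rw [he i hik, TensorProduct.inner_tmul,
        (Submodule.mem_orthogonal _ w).1 hw _ (Submodule.subset_span ⟨i, hik, rfl⟩), mul_zero,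
        zero_smul]
    rw [hu0, hw0, add_zero]
  have := e.orthonormal.1 k
  rw [hz, norm_zero] at this
  exact zero_ne_one this

open scoped Classical in
/-- The indices `i` for which `α i` is on the line of `c`. -/
noncomputable def alignedIndices (α : ι → E) (c : E) : Finset ι :=
  {i | ∃ z : ℂ, α i = z • c}

theorem mem_alignedIndices {α : ι → E} {c : E} {i : ι} :
    i ∈ alignedIndices α c ↔ ∃ z : ℂ, α i = z • c := by
  simp [alignedIndices]

/-- The sesquilinear form of `∑ |β i⟩⟨β i|`, summed over the indices of the line of `c`. -/
noncomputable def alignedForm (α : ι → E) (β : ι → F) (c : E) (x y : F) : ℂ :=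
  ∑ i ∈ alignedIndices α c, inner ℂ x (β i) * inner ℂ (β i) y

variable {e : OrthonormalBasis ι ℂ (E ⊗[ℂ] F)} {α : ι → E} {β : ι → F} {c c' : E}

theorem inner_mul_inner_of_mem (hα : ∀ i, inner ℂ (α i) (α i) = (1 : ℂ))
    {i : ι} (hi : i ∈ alignedIndices α c) (hc : inner ℂ c c = (1 : ℂ)) (x y : E) :
    (inner ℂ x (α i) * inner ℂ (α i) y : ℂ) = inner ℂ x c * inner ℂ c y := by
  obtain ⟨z, hz⟩ := mem_alignedIndices.1 hi
  have h1 := hα i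
  rw [hz, inner_smul_left, inner_smul_right, hc, mul_one] at h1
  rw [hz, inner_smul_left, inner_smul_right]
  linear_combination inner ℂ x c * inner ℂ c y * h1

theorem inner_ne_zero_of_notMem (hp : IsOrthonormalPair c c') {i : ι}
    (hi : i ∉ alignedIndices α c') : inner ℂ c (α i) ≠ (0 : ℂ) := fun h =>
  hi (mem_alignedIndices.2 ⟨_, hp.eq_smul_of_inner_eq_zero h⟩)

theorem disjoint_alignedIndices (hα : ∀ i, inner ℂ (α i) (α i) = (1 : ℂ))
    (hp : IsOrthonormalPair c c') : Disjoint (alignedIndices α c) (alignedIndices α c') := by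
  refine Finset.disjoint_left.2 fun i hi hi' => ?_
  obtain ⟨z, hz⟩ := mem_alignedIndices.1 hi
  obtain ⟨w, hw⟩ := mem_alignedIndices.1 hi'
  have h0 : inner ℂ c (α i) = (0 : ℂ) := by rw [hw, inner_smul_right, hp.inner_eq_zero, mul_zero]
  have h1 : inner ℂ c' (α i) = (0 : ℂ) := by rw [hz, inner_smul_right, hp.inner_eq_zero', mul_zero]
  have h2 := hα i
  rw [hp.inner_eq, h0, h1, mul_zero, mul_zero, add_zero] at h2
  exact zero_ne_one h2

/-- Parseval for `c' ⊗ β j` and `c' ⊗ y`. A term with `α i` off the line of `c'` vanishes: `α i` is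
not orthogonal to `α j`, so `β i` is orthogonal to `β j`, unless `i = j`, and then `α j` is
orthogonal to `c'`. -/
theorem inner_eq_sum_alignedIndices (he : ∀ i, e i = α i ⊗ₜ β i)
    (hα : ∀ i, inner ℂ (α i) (α i) = (1 : ℂ)) (hp : IsOrthonormalPair c c') {j : ι}
    (hj : j ∈ alignedIndices α c) (y : F) :
    (inner ℂ (β j) y : ℂ) =
      ∑ i ∈ alignedIndices α c', inner ℂ (β j) (β i) * inner ℂ (β i) y := by
  classical
  have h := e.sum_inner_mul_inner (c' ⊗ₜ β j) (c' ⊗ₜ y)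
  rw [TensorProduct.inner_tmul, hp.inner_right, one_mul] at h
  rw [← h, ← Finset.sum_subset (Finset.subset_univ (alignedIndices α c'))]
  · refine Finset.sum_congr rfl fun i hi => ?_
    have := inner_mul_inner_of_mem hα hi hp.inner_right c' c'
    rw [hp.inner_right] at this
    rw [he, TensorProduct.inner_tmul, TensorProduct.inner_tmul]
    linear_combination inner ℂ (β j) (β i) * inner ℂ (β i) y * this
  · intro i _ hi
    rw [he, TensorProduct.inner_tmul]
    obtain ⟨z, hz⟩ := mem_alignedIndices.1 hj
    by_cases hij : j = i
    · rw [← hij, hz, inner_smul_right, hp.inner_eq_zero']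
      ring
    · have hne : inner ℂ (α j) (α i) ≠ (0 : ℂ) := by
        rw [hz, inner_smul_left]
        refine mul_ne_zero (fun h0 => ?_) (inner_ne_zero_of_notMem hp hi)
        have h1 := hα j
        rw [hz, inner_smul_left, h0, zero_mul] at h1
        exact zero_ne_one h1
      rw [inner_snd_eq_zero (he j) (he i) hij hne]
      ring

/-- For the operators P, P' of the two forms, `inner_eq_sum_alignedIndices` says that each fixes the
vectors `β i` of the other, so P = P P' = P'. The double sum is P P'. -/
theorem alignedForm_eq (he : ∀ i, e i = α i ⊗ₜ β i) (hα : ∀ i, inner ℂ (α i) (α i) = (1 : ℂ))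
    (hp : IsOrthonormalPair c c') (x y : F) : alignedForm α β c x y = alignedForm α β c' x y := by
  have h1 : alignedForm α β c x y = ∑ j ∈ alignedIndices α c, ∑ i ∈ alignedIndices α c',
      inner ℂ x (β j) * inner ℂ (β j) (β i) * inner ℂ (β i) y := by
    refine Finset.sum_congr rfl fun j hj => ?_
    rw [inner_eq_sum_alignedIndices he hα hp hj y, Finset.mul_sum]
    exact Finset.sum_congr rfl fun i _ => by ring
  have h2 : ∀ i ∈ alignedIndices α c', (inner ℂ x (β i) : ℂ) =
      ∑ j ∈ alignedIndices α c, inner ℂ x (β j) * inner ℂ (β j) (β i) := by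
    intro i hi
    rw [← inner_conj_symm, inner_eq_sum_alignedIndices he hα hp.symm hi x, map_sum]
    refine Finset.sum_congr rfl fun j _ => ?_
    rw [map_mul, inner_conj_symm, inner_conj_symm, mul_comm]
  rw [h1, Finset.sum_comm]
  refine Finset.sum_congr rfl fun i hi => ?_
  rw [h2 i hi, Finset.sum_mul]

theorem alignedIndices_nonempty (he : ∀ i, e i = α i ⊗ₜ β i)
    (hα : ∀ i, inner ℂ (α i) (α i) = (1 : ℂ)) (hβ : ∀ i, inner ℂ (β i) (β i) = (1 : ℂ))
    (hp : IsOrthonormalPair c c') (h : (alignedIndices α c).Nonempty) :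
    (alignedIndices α c').Nonempty := by
  obtain ⟨j, hj⟩ := h
  by_contra h0
  have := inner_eq_sum_alignedIndices he hα hp hj (β j)
  rw [Finset.not_nonempty_iff_eq_empty.1 h0, Finset.sum_empty, hβ] at this
  exact one_ne_zero this

theorem sum_alignedIndices (he : ∀ i, e i = α i ⊗ₜ β i)
    (hα : ∀ i, inner ℂ (α i) (α i) = (1 : ℂ)) (hc : inner ℂ c c = (1 : ℂ)) (a a' : E) (b b' : F) :
    (∑ i ∈ alignedIndices α c, inner ℂ (a ⊗ₜ[ℂ] b) (e i) * inner ℂ (e i) (a' ⊗ₜ[ℂ] b') : ℂ) =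
      inner ℂ a c * inner ℂ c a' * alignedForm α β c b b' := by
  rw [alignedForm, Finset.mul_sum]
  refine Finset.sum_congr rfl fun i hi => ?_
  rw [he, TensorProduct.inner_tmul, TensorProduct.inner_tmul]
  linear_combination (inner ℂ b (β i) * inner ℂ (β i) b') * inner_mul_inner_of_mem hα hi hc a a'

end ProductBasis

/-! ### Angles between coordinate vectors of product vectors. -/

/-- The equality of the squared cosines of the angles between `l` and `m` on `A` and on `B`,
without denominators. -/
def EqualAngles {ι : Type*} (l m : ι → ℝ) (A B : Finset ι) : Prop :=
  (∑ i ∈ A, l i * m i) ^ 2 * ((∑ i ∈ B, l i * l i) * ∑ i ∈ B, m i * m i) =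
    (∑ i ∈ B, l i * m i) ^ 2 * ((∑ i ∈ A, l i * l i) * ∑ i ∈ A, m i * m i)

section EqualAngles

variable {E F ι : Type*} [NormedAddCommGroup E] [InnerProductSpace ℂ E]
  [NormedAddCommGroup F] [InnerProductSpace ℂ F] [Fintype ι]
  {e : OrthonormalBasis ι ℂ (E ⊗[ℂ] F)} {α : ι → E} {β : ι → F} {c c' : E}
  {l m : ι → ℝ} {a a' : E} {b b' : F}

theorem ofReal_sum_mul {v w : E ⊗[ℂ] F} (hv : ∀ i, inner ℂ (e i) v = (l i : ℂ))
    (hw : ∀ i, inner ℂ (e i) w = (m i : ℂ)) (A : Finset ι) :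
    ((∑ i ∈ A, l i * m i : ℝ) : ℂ) = ∑ i ∈ A, inner ℂ v (e i) * inner ℂ (e i) w := by
  rw [Complex.ofReal_sum]
  refine Finset.sum_congr rfl fun i _ => ?_
  rw [hw, ← inner_conj_symm (𝕜 := ℂ) v (e i), hv, Complex.conj_ofReal, Complex.ofReal_mul]

/-- By `sum_alignedIndices` each partial sum is a scalar from the first factors times a form common
to `c` and `c'`; the scalars cancel in the cosine. -/
theorem equalAngles_alignedIndices (he : ∀ i, e i = α i ⊗ₜ β i)
    (hα : ∀ i, inner ℂ (α i) (α i) = (1 : ℂ)) (hp : IsOrthonormalPair c c')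
    (hl : ∀ i, inner ℂ (e i) (a ⊗ₜ b) = (l i : ℂ))
    (hm : ∀ i, inner ℂ (e i) (a' ⊗ₜ b') = (m i : ℂ)) :
    EqualAngles l m (alignedIndices α c) (alignedIndices α c') := by
  have hcomm : ∀ A : Finset ι, ∑ i ∈ A, l i * m i = ∑ i ∈ A, m i * l i := fun A =>
    Finset.sum_congr rfl fun i _ => mul_comm _ _
  apply Complex.ofReal_injective
  rw [sq, sq]
  -- The sums are real, so ⟨v, w⟩ and ⟨w, v⟩ agree on each set; using one of each turns the square
  -- into a squared modulus, whose factors match those of the norms.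
  nth_rewrite 2 [hcomm (alignedIndices α c)]
  nth_rewrite 2 [hcomm (alignedIndices α c')]
  simp only [Complex.ofReal_mul, ofReal_sum_mul hl hl, ofReal_sum_mul hl hm, ofReal_sum_mul hm hl,
    ofReal_sum_mul hm hm, sum_alignedIndices he hα hp.inner_left,
    sum_alignedIndices he hα hp.inner_right, alignedForm_eq he hα hp]
  ring

/-- If the lines of an orthonormal pair contain one first factor each, then the partial sums over
these two indices are inner products of product vectors. -/
theorem sum_pair (he : ∀ i, e i = α i ⊗ₜ β i)
    (hα : ∀ i, inner ℂ (α i) (α i) = (1 : ℂ)) (hp : IsOrthonormalPair c c') [DecidableEq ι]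
    {j j' : ι} (hj : alignedIndices α c = {j}) (hj' : alignedIndices α c' = {j'}) (hjj' : j ≠ j')
    (x x' : E) (y y' : F) :
    (∑ i ∈ {j, j'}, inner ℂ (x ⊗ₜ[ℂ] y) (e i) * inner ℂ (e i) (x' ⊗ₜ[ℂ] y') : ℂ) =
      inner ℂ x x' * (inner ℂ y (β j) * inner ℂ (β j) y') := by
  have h1 := sum_alignedIndices he hα hp.inner_left x x' y y'
  have h2 := sum_alignedIndices he hα hp.inner_right x x' y y'
  rw [← alignedForm_eq he hα hp] at h2
  have h3 : alignedForm α β c y y' = inner ℂ y (β j) * inner ℂ (β j) y' := by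
    rw [alignedForm, hj, Finset.sum_singleton]
  rw [hj, Finset.sum_singleton, h3] at h1
  rw [hj', Finset.sum_singleton, h3] at h2
  rw [Finset.sum_pair hjj', h1, h2, hp.inner_eq x x']
  ring

/-- By `sum_pair` the second factors cancel in the cosine, which leaves the angle between `a` and
`a'`, the same for every pair. -/
theorem equalAngles_pair (he : ∀ i, e i = α i ⊗ₜ β i)
    (hα : ∀ i, inner ℂ (α i) (α i) = (1 : ℂ)) [DecidableEq ι] {d d' : E}
    (hp : IsOrthonormalPair c c') (hq : IsOrthonormalPair d d') {j j' k k' : ι}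
    (hj : alignedIndices α c = {j}) (hj' : alignedIndices α c' = {j'}) (hjj' : j ≠ j')
    (hk : alignedIndices α d = {k}) (hk' : alignedIndices α d' = {k'}) (hkk' : k ≠ k')
    (hl : ∀ i, inner ℂ (e i) (a ⊗ₜ b) = (l i : ℂ))
    (hm : ∀ i, inner ℂ (e i) (a' ⊗ₜ b') = (m i : ℂ)) :
    EqualAngles l m {j, j'} {k, k'} := by
  have hcomm : ∀ A : Finset ι, ∑ i ∈ A, l i * m i = ∑ i ∈ A, m i * l i := fun A =>
    Finset.sum_congr rfl fun i _ => mul_comm _ _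
  apply Complex.ofReal_injective
  rw [sq, sq]
  nth_rewrite 2 [hcomm {j, j'}]
  nth_rewrite 2 [hcomm {k, k'}]
  simp only [Complex.ofReal_mul, ofReal_sum_mul hl hl, ofReal_sum_mul hl hm, ofReal_sum_mul hm hl,
    ofReal_sum_mul hm hm, sum_pair he hα hp hj hj' hjj', sum_pair he hα hq hk hk' hkk']
  ring

theorem mem_alignedIndices_of_mem (hα : ∀ i, inner ℂ (α i) (α i) = (1 : ℂ)) {i j : ι}
    (hi : i ∈ alignedIndices α c) (hj : j ∈ alignedIndices α c) :
    i ∈ alignedIndices α (α j) := by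
  obtain ⟨z, hz⟩ := mem_alignedIndices.1 hi
  obtain ⟨w, hw⟩ := mem_alignedIndices.1 hj
  have hw0 : w ≠ 0 := by
    rintro rfl
    have := hα j
    rw [hw, zero_smul, inner_zero_left] at this
    exact zero_ne_one this
  exact mem_alignedIndices.2 ⟨z * w⁻¹, by rw [hz, hw, smul_smul, inv_mul_cancel_right₀ hw0]⟩

/-- Expansions of product vectors with real coefficients `l`, `m` in an orthonormal basis of
product vectors give two index sets on which `l` and `m` form the same angle. -/
theorem exists_equalAngles (he : ∀ i, e i = α i ⊗ₜ β i)
    (hα : ∀ i, inner ℂ (α i) (α i) = (1 : ℂ)) (hβ : ∀ i, inner ℂ (β i) (β i) = (1 : ℂ))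
    (hE : ∀ c : E, inner ℂ c c = (1 : ℂ) → ∃ c', IsOrthonormalPair c c')
    (hι : 3 ≤ Fintype.card ι)
    (hl : ∀ i, inner ℂ (e i) (a ⊗ₜ b) = (l i : ℂ))
    (hm : ∀ i, inner ℂ (e i) (a' ⊗ₜ b') = (m i : ℂ)) :
    ∃ A B : Finset ι, Disjoint A B ∧ 1 < A.card ∧ B.Nonempty ∧ EqualAngles l m A B := by
  classical
  have self_mem : ∀ i, i ∈ alignedIndices α (α i) := fun i =>
    mem_alignedIndices.2 ⟨1, (one_smul ℂ _).symm⟩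
  by_cases hbig : ∃ j, 1 < (alignedIndices α (α j)).card
  · obtain ⟨j, hj⟩ := hbig
    obtain ⟨c', hc'⟩ := hE (α j) (hα j)
    exact ⟨_, _, disjoint_alignedIndices hα hc', hj,
      alignedIndices_nonempty he hα hβ hc' ⟨j, self_mem j⟩,
      equalAngles_alignedIndices he hα hc' hl hm⟩
  -- Here single lines carry no information, as any angle on one index is zero. Each set is instead
  -- the two indices of an orthogonal pair of lines.
  · push Not at hbig
    have single : ∀ {c i}, i ∈ alignedIndices α c → alignedIndices α c = {i} := by
      intro c i hi
      refine Finset.eq_singleton_iff_unique_mem.2 ⟨hi, fun k hk => ?_⟩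
      exact Finset.card_le_one.1 (hbig i) _ (mem_alignedIndices_of_mem hα hk hi) _ (self_mem i)
    have partner : ∀ j, ∃ c' j', IsOrthonormalPair (α j) c' ∧ alignedIndices α (α j) = {j} ∧
        alignedIndices α c' = {j'} ∧ j ≠ j' := by
      intro j
      obtain ⟨c', hc'⟩ := hE (α j) (hα j)
      obtain ⟨j', hj'⟩ := alignedIndices_nonempty he hα hβ hc' ⟨j, self_mem j⟩
      exact ⟨c', j', hc', single (self_mem j), single hj', fun h =>
        Finset.disjoint_left.1 (disjoint_alignedIndices hα hc') (self_mem j) (h ▸ hj')⟩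
    obtain ⟨j⟩ : Nonempty ι := Fintype.card_pos_iff.1 (by omega)
    obtain ⟨c', j', hc, hj, hj', hjj'⟩ := partner j
    obtain ⟨k, -, hk⟩ := Finset.exists_mem_notMem_of_card_lt_card
      (s := {j, j'}) (t := Finset.univ) (by rw [Finset.card_pair hjj', Finset.card_univ]; omega)
    obtain ⟨d', k', hd, hkd, hkd', hkk'⟩ := partner k
    simp only [Finset.mem_insert, Finset.mem_singleton, not_or] at hk
    have hk'd : inner ℂ (α k) (α k') = (0 : ℂ) := by
      obtain ⟨z, hz⟩ := mem_alignedIndices.1 (hkd'.symm ▸ Finset.mem_singleton_self k')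
      rw [hz, inner_smul_right, hd.inner_eq_zero, mul_zero]
    have hk'd' : inner ℂ (α k') (α k) = (0 : ℂ) := by rw [← inner_conj_symm, hk'd, map_zero]
    -- Taking partners is an involution, so the partner of an index outside `{j, j'}` is outside
    -- too.
    have h1 : k' ≠ j := by
      rintro rfl
      have : k ∈ alignedIndices α c' := mem_alignedIndices.2 ⟨_, hc.eq_smul_of_inner_eq_zero hk'd'⟩
      rw [hj', Finset.mem_singleton] at this
      exact hk.2 this
    have h2 : k' ≠ j' := by
      rintro rfl
      obtain ⟨z, hz⟩ := mem_alignedIndices.1 (hj'.symm ▸ Finset.mem_singleton_self k')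
      have hz0 : z ≠ 0 := by
        rintro rfl
        have := hα k'
        rw [hz, zero_smul, inner_zero_left] at this
        exact zero_ne_one this
      rw [hz, inner_smul_right] at hk'd
      have h0 := (mul_eq_zero.1 hk'd).resolve_left hz0
      have : inner ℂ c' (α k) = (0 : ℂ) := by rw [← inner_conj_symm, h0, map_zero]
      have : k ∈ alignedIndices α (α j) :=
        mem_alignedIndices.2 ⟨_, hc.symm.eq_smul_of_inner_eq_zero this⟩
      rw [hj, Finset.mem_singleton] at this
      exact hk.1 this
    refine ⟨{j, j'}, {k, k'}, ?_, ?_, ⟨k, by simp⟩,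
      equalAngles_pair he hα hc hd hj hj' hjj' hkd hkd' hkk' hl hm⟩
    · simp only [Finset.disjoint_insert_left, Finset.disjoint_singleton_left, Finset.mem_insert,
        Finset.mem_singleton, not_or]
      exact ⟨⟨Ne.symm hk.1, h1.symm⟩, Ne.symm hk.2, h2.symm⟩
    · rw [Finset.card_pair hjj']
      exact one_lt_two

end EqualAngles

/-! ### Lacunary polynomials and base-p digits. -/

open Polynomial in
/-- `∑ X ^ (r p ^ (j + 1))` over the indices `j ∈ A`. -/
noncomputable def lacunaryPoly {d : ℕ} (p : ℕ) (A : Finset (Fin d)) (r : ℕ) : Polynomial ℝ :=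
  ∑ j ∈ A, X ^ (r * p ^ ((j : ℕ) + 1))

/-- Uniqueness of digits in base `p`. -/
theorem eq_of_sum_mul_pow_eq {p d : ℕ} {f g : Fin d → ℕ} (hf : ∀ i, f i < p) (hg : ∀ i, g i < p)
    (h : ∑ i, f i * p ^ (i : ℕ) = ∑ i, g i * p ^ (i : ℕ)) : f = g := by
  induction d with
  | zero => exact Subsingleton.elim _ _
  | succ d ih =>
    have hp : 0 < p := (Nat.zero_le _).trans_lt (hf 0)
    have key : ∀ f : Fin (d + 1) → ℕ, ∑ i, f i * p ^ (i : ℕ) =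
        f 0 + p * ∑ i : Fin d, f i.succ * p ^ (i : ℕ) := by
      intro f
      rw [Fin.sum_univ_succ, Finset.mul_sum, Fin.val_zero, pow_zero, mul_one]
      congr 1
      exact Finset.sum_congr rfl fun i _ => by rw [Fin.val_succ, pow_succ]; ring
    rw [key, key] at h
    have h0 : f 0 = g 0 := by
      have := congrArg (· % p) h
      simpa [Nat.add_mul_mod_self_left, Nat.mod_eq_of_lt (hf 0), Nat.mod_eq_of_lt (hg 0)] using this
    rw [h0] at h
    have ht := ih (f := fun i => f i.succ) (g := fun i => g i.succ) (fun i => hf _) (fun i => hg _)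
      (Nat.eq_of_mul_eq_mul_left hp (Nat.add_left_cancel h))
    funext i
    refine Fin.cases h0 (fun i => congrFun ht i) i

/-- The left side has digit 3 at `i`, since `j ≠ i` and `k ∈ B`. On the right only 2 and 4 can
contribute there, so that digit is even. As `A` and `B` are disjoint, no digit exceeds 6 and there
are no carries. -/
theorem exponent_ne {p d : ℕ} (hp : 7 < p) {A B : Finset (Fin d)} (hAB : Disjoint A B)
    {i j k a b u v : Fin d} (hi : i ∈ A) (hj : j ∈ A) (hij : i ≠ j) (hk : k ∈ B)
    (ha : a ∈ A) (hb : b ∈ A) (hu : u ∈ B) (hv : v ∈ B) :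
    3 * p ^ ((i : ℕ) + 1) + 3 * p ^ ((j : ℕ) + 1) +
        (2 * p ^ ((k : ℕ) + 1) + 4 * p ^ ((k : ℕ) + 1)) ≠
      3 * p ^ ((u : ℕ) + 1) + 3 * p ^ ((v : ℕ) + 1) +
        (2 * p ^ ((a : ℕ) + 1) + 4 * p ^ ((b : ℕ) + 1)) := by
  intro h
  have hne : ∀ {s t}, s ∈ A → t ∈ B → s ≠ t := fun hs ht hst =>
    Finset.disjoint_left.1 hAB hs (hst ▸ ht)
  have hsum : ∀ (r : ℕ) (s : Fin d), ∑ t, (if t = s then r else 0) * p ^ (t : ℕ) =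
      r * p ^ (s : ℕ) := by
    intro r s
    simp [ite_mul]
  have h' := eq_of_sum_mul_pow_eq (p := p)
    (f := fun t => (if t = i then 3 else 0) + (if t = j then 3 else 0) +
      ((if t = k then 2 else 0) + (if t = k then 4 else 0)))
    (g := fun t => (if t = u then 3 else 0) + (if t = v then 3 else 0) +
      ((if t = a then 2 else 0) + (if t = b then 4 else 0))) ?_ ?_ ?_
  · have := congrFun h' i
    simp only [if_true, if_neg hij, if_neg (hne hi hk), if_neg (hne hi hu),
      if_neg (hne hi hv)] at this
    split_ifs at this <;> omega
  · intro t
    have h1 := hne hi hk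
    have h2 := hne hj hk
    split_ifs <;> omega
  · intro t
    have h1 := hne ha hu
    have h2 := hne ha hv
    have h3 := hne hb hu
    have h4 := hne hb hv
    split_ifs <;> omega
  · simp only [add_mul, Finset.sum_add_distrib, hsum]
    -- The exponents start at p^1 and the digit expansion at p^0, hence the extra factor p.
    refine Nat.eq_of_mul_eq_mul_right (show 0 < p by omega) ?_
    simp only [pow_succ] at h
    linarith

open Polynomial in
theorem lacunaryPoly_mul {d p : ℕ} (A B : Finset (Fin d)) :
    lacunaryPoly p A 3 ^ 2 * (lacunaryPoly p B 2 * lacunaryPoly p B 4) =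
      ∑ i ∈ A, ∑ j ∈ A, ∑ k ∈ B, ∑ l ∈ B,
        (X ^ (3 * p ^ ((i : ℕ) + 1) + 3 * p ^ ((j : ℕ) + 1) +
          (2 * p ^ ((k : ℕ) + 1) + 4 * p ^ ((l : ℕ) + 1))) : ℝ[X]) := by
  simp only [lacunaryPoly]
  rw [sq, Finset.sum_mul_sum, Finset.sum_mul_sum, Finset.sum_mul]
  refine Finset.sum_congr rfl fun i _ => ?_
  rw [Finset.sum_mul]
  refine Finset.sum_congr rfl fun j _ => ?_
  rw [Finset.mul_sum]
  refine Finset.sum_congr rfl fun k _ => ?_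
  rw [Finset.mul_sum]
  refine Finset.sum_congr rfl fun l _ => ?_
  rw [pow_add X (_ + _), pow_add X (3 * _), pow_add X (2 * _)]

/-- Coefficients are nonnegative, so nothing cancels: the monomial of `exponent_ne` occurs on the
left only. -/
theorem lacunaryPoly_mul_ne {p d : ℕ} (hp : 7 < p) {A B : Finset (Fin d)} (hAB : Disjoint A B)
    (hA : 1 < A.card) (hB : B.Nonempty) :
    lacunaryPoly p A 3 ^ 2 * (lacunaryPoly p B 2 * lacunaryPoly p B 4) ≠
      lacunaryPoly p B 3 ^ 2 * (lacunaryPoly p A 2 * lacunaryPoly p A 4) := by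
  obtain ⟨i, hi, j, hj, hij⟩ := Finset.one_lt_card.1 hA
  obtain ⟨k, hk⟩ := hB
  rw [lacunaryPoly_mul, lacunaryPoly_mul]
  refine fun h => absurd (congrArg (Polynomial.coeff · (3 * p ^ ((i : ℕ) + 1) +
    3 * p ^ ((j : ℕ) + 1) + (2 * p ^ ((k : ℕ) + 1) + 4 * p ^ ((k : ℕ) + 1)))) h) (ne_of_gt ?_)
  simp only [Polynomial.finsetSum_coeff, Polynomial.coeff_X_pow]
  have hnn : ∀ q : Prop, ∀ [Decidable q], (0 : ℝ) ≤ if q then 1 else 0 := by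
    intro q _
    split_ifs <;> norm_num
  refine (Finset.sum_eq_zero fun u hu => Finset.sum_eq_zero fun v hv =>
    Finset.sum_eq_zero fun a ha => Finset.sum_eq_zero fun b hb =>
      if_neg (exponent_ne hp hAB hi hj hij hk ha hb hu hv)).trans_lt ?_
  refine Finset.sum_pos' (fun _ _ => Finset.sum_nonneg fun _ _ => Finset.sum_nonneg fun _ _ =>
    Finset.sum_nonneg fun _ _ => hnn _) ⟨i, hi, ?_⟩
  refine Finset.sum_pos' (fun _ _ => Finset.sum_nonneg fun _ _ =>
    Finset.sum_nonneg fun _ _ => hnn _) ⟨j, hj, ?_⟩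
  refine Finset.sum_pos' (fun _ _ => Finset.sum_nonneg fun _ _ => hnn _) ⟨k, hk, ?_⟩
  refine Finset.sum_pos' (fun _ _ => hnn _) ⟨k, hk, ?_⟩
  rw [if_pos rfl]
  exact one_pos

theorem finite_setOf_equalAngles {p d : ℕ} (hp : 7 < p) {A B : Finset (Fin d)}
    (hAB : Disjoint A B) (hA : 1 < A.card) (hB : B.Nonempty) :
    {x : ℝ | EqualAngles (fun j : Fin d => x ^ (1 * p ^ ((j : ℕ) + 1)))
      (fun j : Fin d => x ^ (2 * p ^ ((j : ℕ) + 1))) A B}.Finite := by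
  refine (Polynomial.finite_setOfPred_isRoot
    (sub_ne_zero.2 (lacunaryPoly_mul_ne hp hAB hA hB))).subset fun x hx => ?_
  have h : ∀ (C : Finset (Fin d)) (r s : ℕ),
      ∑ j ∈ C, x ^ (r * p ^ ((j : ℕ) + 1)) * x ^ (s * p ^ ((j : ℕ) + 1)) =
        (lacunaryPoly p C (r + s)).eval x := by
    intro C r s
    rw [lacunaryPoly, Polynomial.eval_finsetSum]
    refine Finset.sum_congr rfl fun j _ => ?_
    rw [Polynomial.eval_pow, Polynomial.eval_X, ← pow_add, ← add_mul]
  simp only [Set.mem_ofPred_eq, EqualAngles, h] at hx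
  simp only [Set.mem_ofPred_eq, Polynomial.IsRoot, Polynomial.eval_sub, Polynomial.eval_mul,
    Polynomial.eval_pow]
  exact sub_eq_zero.2 hx

/-! ### Unitaries and the set of states. -/

/-- The isometry of `ℂᵈ` given by a unitary matrix. -/
theorem exists_linearIsometryEquiv_of_mem_unitaryGroup {d : ℕ} {U : Matrix (Fin d) (Fin d) ℂ}
    (hU : U ∈ Matrix.unitaryGroup (Fin d) ℂ) :
    ∃ L : EuclideanSpace ℂ (Fin d) ≃ₗᵢ[ℂ] EuclideanSpace ℂ (Fin d),
      ∀ v, L v = Matrix.toEuclideanLin U v := by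
  have h : ∀ v w, inner ℂ (Matrix.toEuclideanLin U v) (Matrix.toEuclideanLin U w) =
      (inner ℂ v w : ℂ) := by
    intro v w
    rw [← LinearMap.adjoint_inner_right, ← Matrix.toEuclideanLin_conjTranspose_eq_adjoint]
    congr 1
    have := (Matrix.mem_unitaryGroup_iff'.1 hU)
    rw [Matrix.star_eq_conjTranspose] at this
    simp only [Matrix.toLpLin_apply, Matrix.mulVec_mulVec, this, Matrix.one_mulVec]
  exact ⟨(LinearMap.isometryOfInner _ h).toLinearIsometryEquiv rfl, fun v => rfl⟩

section powerState

variable {d : ℕ} (ξ : OrthonormalBasis (Fin d) ℂ (EuclideanSpace ℂ (Fin d))) (p : ℕ) (x : ℝ)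

theorem inner_powerState (m : ℕ) (i : Fin d) :
    inner ℂ (ξ i) (powerState ξ p m x) = ((x ^ (m * p ^ ((i : ℕ) + 1)) : ℝ) : ℂ) :=
  ξ.orthonormal.inner_right_fintype _ i

/-- The power states differ in their first coordinate, x^p against x^(2p), and their last coordinate
is nonzero, unlike that of the basis vectors in the set. -/
theorem ncard_stateSet (hd : 0 < d) (hp : 0 < p) (hx : x ∈ Set.Ioo (0 : ℝ) 1) :
    (stateSet ξ p x).ncard = d + 1 := by
  have hset : {i : Fin d | (i : ℕ) + 1 < d} = ↑(Finset.univ.erase (⟨d - 1, by omega⟩ : Fin d)) := by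
    ext i
    simp only [Set.mem_ofPred_eq, Finset.coe_erase, Finset.coe_univ, Set.mem_sdiff, Set.mem_univ,
      Set.mem_singleton_iff, true_and, Fin.ext_iff]
    have := i.2
    omega
  have hne : powerState ξ p 1 x ≠ powerState ξ p 2 x := by
    intro h
    have h' := congrArg (inner ℂ (ξ ⟨0, hd⟩)) h
    rw [inner_powerState, inner_powerState, Complex.ofReal_inj] at h'
    have := pow_right_injective₀ hx.1 hx.2.ne h'
    have hpos : 0 < p ^ (((⟨0, hd⟩ : Fin d) : ℕ) + 1) := pow_pos hp _
    exact absurd (Nat.eq_of_mul_eq_mul_right hpos this) (by norm_num)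
  have hdisj : Disjoint (ξ '' {i : Fin d | (i : ℕ) + 1 < d})
      {powerState ξ p 1 x, powerState ξ p 2 x} := by
    rw [Set.disjoint_left]
    have key : ∀ m, ∀ i : Fin d, (i : ℕ) + 1 < d → ξ i ≠ powerState ξ p m x := by
      intro m i hi h
      have h' := congrArg (inner ℂ (ξ ⟨d - 1, by omega⟩)) h
      rw [inner_powerState, ξ.inner_eq_zero (by rw [Ne, Fin.ext_iff]; simp only; omega)] at h'
      exact (pow_pos hx.1 _).ne (by exact_mod_cast h')
    rintro _ ⟨i, hi, rfl⟩ (h | h)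
    · exact key 1 i hi h
    · exact key 2 i hi h
  rw [stateSet, Set.ncard_union_eq hdisj ((Set.toFinite _).image _) (Set.toFinite _),
    Set.ncard_image_of_injective _ ξ.orthonormal.linearIndependent.injective, hset, Set.ncard_coe_finset,
    Finset.card_erase_of_mem (Finset.mem_univ _), Finset.card_univ, Fintype.card_fin,
    Set.ncard_pair hne]
  omega

end powerState

/-- If a unitary maps all states of `stateSet` to product vectors, then the coefficients of the two
power states form the same angle on two disjoint sets of indices. -/
theorem exists_equalAngles_of_not_isAbsolutelyEntangled {n p : ℕ} (hn : 2 ≤ n) {x : ℝ}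
    (ξ : OrthonormalBasis (Fin (2 * n)) ℂ (EuclideanSpace ℂ (Fin (2 * n))))
    (h : ¬ IsAbsolutelyEntangled 2 n (stateSet ξ p x)) :
    ∃ A B : Finset (Fin (2 * n)), Disjoint A B ∧ 1 < A.card ∧ B.Nonempty ∧
      EqualAngles (fun j : Fin (2 * n) => x ^ (1 * p ^ ((j : ℕ) + 1)))
        (fun j : Fin (2 * n) => x ^ (2 * p ^ ((j : ℕ) + 1))) A B := by
  simp only [IsAbsolutelyEntangled, IsEntangled] at h
  push Not at h
  obtain ⟨U, hU, hprod⟩ := h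
  obtain ⟨L, hL⟩ := exists_linearIsometryEquiv_of_mem_unitaryGroup hU
  set T := L.trans (tensorIso 2 n).symm with hT
  have hprodT : ∀ ψ ∈ stateSet ξ p x, ∃ a b, T ψ = a ⊗ₜ[ℂ] b := by
    intro ψ hψ
    obtain ⟨a, b, hab⟩ := hprod ψ hψ
    exact ⟨a, b, by rw [hT, LinearIsometryEquiv.trans_apply, hL, hab,
      LinearIsometryEquiv.symm_apply_apply]⟩
  set e := ξ.map T with he
  have heT : ∀ i, e i = T (ξ i) := fun i => ξ.map_apply T i
  have unit : ∀ i, (∃ a b, e i = a ⊗ₜ[ℂ] b) → ∃ (α : EuclideanSpace ℂ (Fin 2))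
      (β : EuclideanSpace ℂ (Fin n)), inner ℂ α α = (1 : ℂ) ∧ inner ℂ β β = (1 : ℂ) ∧
        e i = α ⊗ₜ[ℂ] β := by
    rintro i ⟨a, b, hab⟩
    have := e.orthonormal.1 i
    rw [hab] at this
    rw [hab]
    exact exists_unit_tmul this
  let k : Fin (2 * n) := ⟨2 * n - 1, by omega⟩
  have hinit : ∀ i, i ≠ k → ∃ (α : EuclideanSpace ℂ (Fin 2))
      (β : EuclideanSpace ℂ (Fin n)), inner ℂ α α = (1 : ℂ) ∧ inner ℂ β β = (1 : ℂ) ∧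
        e i = α ⊗ₜ[ℂ] β := by
    intro i hi
    refine unit i ?_
    rw [heT]
    refine hprodT _ (Or.inl ⟨i, ?_, rfl⟩)
    have h1 : (i : ℕ) ≠ 2 * n - 1 := fun h => hi (Fin.ext h)
    have := i.2
    simp only [Set.mem_ofPred_eq]
    omega
  have hlast : ∃ a b, e k = a ⊗ₜ[ℂ] b := by
    choose! α β hα hβ hαβ using hinit
    exact exists_eq_tmul_of_forall_ne e k α β hαβ hα
  have hall : ∀ i, ∃ (α : EuclideanSpace ℂ (Fin 2)) (β : EuclideanSpace ℂ (Fin n)),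
      inner ℂ α α = (1 : ℂ) ∧ inner ℂ β β = (1 : ℂ) ∧ e i = α ⊗ₜ[ℂ] β := fun i => by
    by_cases hi : i = k
    · rw [hi]
      exact unit k hlast
    · exact hinit i hi
  choose α β hα hβ hαβ using hall
  obtain ⟨a, b, hab⟩ := hprodT (powerState ξ p 1 x) (Or.inr (Or.inl rfl))
  obtain ⟨a', b', hab'⟩ := hprodT (powerState ξ p 2 x) (Or.inr (Or.inr rfl))
  refine exists_equalAngles hαβ hα hβ exists_isOrthonormalPair (by rw [Fintype.card_fin]; omega)
    (a := a) (b := b) (a' := a') (b' := b') (fun i => ?_) (fun i => ?_)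
  · rw [← hab, heT, T.inner_map_map, inner_powerState]
  · rw [← hab', heT, T.inner_map_map, inner_powerState]

theorem theorem2 (n : ℕ) (hn : 2 ≤ n) (p : ℕ) (hp : 7 < p)
    (ξ : OrthonormalBasis (Fin (2 * n)) ℂ (EuclideanSpace ℂ (Fin (2 * n)))) :
    {x : ℝ | x ∈ Set.Ioo (0 : ℝ) 1 ∧
      ¬ ((stateSet ξ p x).ncard = 2 * n + 1 ∧
        IsAbsolutelyEntangled 2 n (stateSet ξ p x))}.Finite := by
  have hfin : (⋃ q ∈ {q : Finset (Fin (2 * n)) × Finset (Fin (2 * n)) |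
      Disjoint q.1 q.2 ∧ 1 < q.1.card ∧ q.2.Nonempty},
      {x : ℝ | EqualAngles (fun j : Fin (2 * n) => x ^ (1 * p ^ ((j : ℕ) + 1)))
        (fun j : Fin (2 * n) => x ^ (2 * p ^ ((j : ℕ) + 1))) q.1 q.2}).Finite :=
    (Set.toFinite _).biUnion fun q hq => finite_setOf_equalAngles hp hq.1 hq.2.1 hq.2.2
  refine hfin.subset fun x hx => ?_
  -- The count holds for every x in (0, 1), so only the entanglement can fail.
  have hnot : ¬ IsAbsolutelyEntangled 2 n (stateSet ξ p x) := fun h =>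
    hx.2 ⟨ncard_stateSet ξ p x (by omega) (by omega) hx.1, h⟩
  obtain ⟨A, B, hAB, hA, hB, h⟩ := exists_equalAngles_of_not_isAbsolutelyEntangled hn ξ hnot
  exact Set.mem_biUnion (x := (A, B)) ⟨hAB, hA, hB⟩ h
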